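/- All graphs are finite and simple. For a group $G$ and a prime $p$, $\mathrm{O}_p(G)$ denotes the largest normal $p$-subgroup of $G$. A transitive permutation group is called semiprimitive if each of its normal subgroups is either transitive or semiregular (that is, has trivial point-stabilisers). For a permutation group $L$, a pair $(\Gamma,G)$ is called locally-$L$ if $\Gamma$ is a connected graph, $G$ is a subgroup of $\mathrm{Aut}(\Gamma)$ acting transitively on the vertices of $\Gamma$, and, for a vertex $v$ of $\Gamma$, the permutation group $G_v^{\Gamma(v)}$ induced by the vertex-stabiliser $G_v$ on the neighbourhood $\Gamma(v)$ is permutation isomorphic to $L$ (up to permutation isomorphism, $G_v^{\Gamma(v)}$ does not depend on $v$). For a prime $p$, a transitive permutation group $L$ is called $p$-graph-restrictive if there is a constant $c(p,L)$ such that, for every locally-$L$ pair $(\Gamma,G)$ and every arc $(u,v)$ of $\Gamma$ (ordered pair of adjacent vertices), the largest power of $p$ dividing the order of the arc-stabiliser $G_{uv}=G_u\cap G_v$ is at most $c(p,L)$. Corollary 2.3. Let $L$ be a semiprimitive group acting on a set $\Omega$, let $x\in\Omega$ and let $p$ be a prime. If $\mathrm{O}_p(L_x)=1$, then $L$ is $p$-graph-restrictive.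 -/

import Mathlib

universe u w

/-- `O_p(G)`: the largest normal `p`-subgroup of `G`, as the join of all normal `p`-subgroups
(see `pCore_isGreatest`). -/
def pCore (p : ℕ) (G : Type*) [Group G] : Subgroup G :=
  sSup {N : Subgroup G | N.Normal ∧ IsPGroup p N}

theorem pCore_isGreatest (p : ℕ) [Fact p.Prime] (G : Type*) [Group G] :
    IsGreatest {N : Subgroup G | N.Normal ∧ IsPGroup p N} (pCore p G) := by
  refine ⟨⟨?_, ?_⟩, fun N hN => le_sSup hN⟩
  · unfold pCore
    rw [sSup_eq_iSup']
    have (N : {N : Subgroup G | N.Normal ∧ IsPGroup p N}) : (N : Subgroup G).Normal := N.2.1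
    infer_instance
  · have hne : {N : Subgroup G | N.Normal ∧ IsPGroup p N}.Nonempty :=
      ⟨⊥, inferInstance, IsPGroup.of_bot⟩
    have hdir : DirectedOn (· ≤ ·) {N : Subgroup G | N.Normal ∧ IsPGroup p N} := by
      rintro A ⟨hA, hA'⟩ B ⟨hB, hB'⟩
      exact ⟨A ⊔ B, ⟨inferInstance, hA'.to_sup_of_normal_right hB'⟩, le_sup_left, le_sup_right⟩
    rintro ⟨g, hg⟩
    obtain ⟨N, hN, hgN⟩ := (Subgroup.mem_sSup_of_directedOn hne hdir).1 hg
    obtain ⟨k, hk⟩ := hN.2 ⟨g, hgN⟩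
    exact ⟨k, Subtype.ext (by simpa using congrArg Subtype.val hk)⟩

/-- The action of `G` on `Ω` is semiregular: all point stabilisers are trivial. -/
def IsSemiregularAction (G Ω : Type*) [Group G] [MulAction G Ω] : Prop :=
  ∀ x : Ω, MulAction.stabilizer G x = ⊥

/-- A permutation group `L` on `Ω` is semiprimitive if it is transitive and each of its normal
subgroups is transitive or semiregular on `Ω`. -/
def IsSemiprimitive {Ω : Type*} (L : Subgroup (Equiv.Perm Ω)) : Prop :=
  MulAction.IsPretransitive L Ω ∧
    ∀ N : Subgroup L, N.Normal → MulAction.IsPretransitive N Ω ∨ IsSemiregularAction N Ω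

section LocalAction

variable {V : Type*} {Γ : SimpleGraph V} (G : Subgroup (Γ ≃g Γ))

/-- The homomorphism `G_v → Sym(Γ(v))` given by restricting an element of the vertex stabiliser
to the neighbourhood of `v`. -/
def localHom (v : V) :
    MulAction.stabilizer G v →* Equiv.Perm (Γ.neighborSet v) where
  toFun g :=
    Equiv.Perm.subtypePerm (g.1.1 : V ≃ V) fun w => by
      have hg : (g.1.1 : Γ ≃g Γ) v = v := g.2
      have h := (g.1.1 : Γ ≃g Γ).map_adj_iff (v := v) (w := w)
      rw [hg] at h
      exact h
  map_one' := rfl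
  map_mul' _ _ := rfl

/-- `G_v^{Γ(v)}`: the permutation group on the neighbourhood of `v` induced by `G_v`. -/
def localAction (v : V) : Subgroup (Equiv.Perm (Γ.neighborSet v)) :=
  (localHom G v).range

/-- The stabiliser `G_{uv}` of the arc `(u, v)`. -/
def arcStabilizer (u v : V) : Subgroup G :=
  MulAction.stabilizer G u ⊓ MulAction.stabilizer G v

end LocalAction

/-- Permutation groups `L` on `Ω` and `M` on `Ω'` are permutation isomorphic: some bijection
`Ω ≃ Ω'` carries `L` onto `M`. -/
def PermIsomorphic {Ω Ω' : Type*} (L : Subgroup (Equiv.Perm Ω)) (M : Subgroup (Equiv.Perm Ω')) :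
    Prop :=
  ∃ e : Ω ≃ Ω', L.map e.permCongrHom.toMonoidHom = M

/-- `(Γ, G)` is a locally-`L` pair: `Γ` is connected, `G ≤ Aut(Γ)` is vertex-transitive, and `L` is
permutation isomorphic to `G_v^{Γ(v)}` for some vertex `v`
(equivalently every one, by vertex-transitivity). -/
structure IsLocally {Ω V : Type*} (L : Subgroup (Equiv.Perm Ω)) (Γ : SimpleGraph V)
    (G : Subgroup (Γ ≃g Γ)) : Prop where
  connected : Γ.Connected
  vertexTransitive : MulAction.IsPretransitive G V
  local_iso : ∃ v : V, PermIsomorphic L (localAction G v)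

/-- A transitive permutation group `L` is `p`-graph-restrictive if there is a constant `c` such
that, for all locally-`L` pairs `(Γ, G)` with `Γ` finite and all arcs `(u, v)` of `Γ`, the largest
power of `p` dividing `|G_{uv}|` is at most `c`. -/
def IsPGraphRestrictive {Ω : Type u} (p : ℕ) (L : Subgroup (Equiv.Perm Ω)) : Prop :=
  MulAction.IsPretransitive L Ω ∧
    ∃ c : ℕ, ∀ (V : Type w) [Finite V] (Γ : SimpleGraph V) (G : Subgroup (Γ ≃g Γ)),
      IsLocally L Γ G → ∀ u v : V, Γ.Adj u v →
        p ^ (Nat.card (arcStabilizer G u v)).factorization p ≤ c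

/-! Let H be the stabiliser of an arc (v, u), let K_v and K_u be the kernels of the local actions at
v and u, and put K = K_v ∩ K_u. Both kernels have index at most |L| in H, so |H : K| ≤ |L|², and it
suffices that p does not divide |K|. Connectivity makes any subgroup of H trivial if it is
normalised by G_v and by an element g reversing the arc (`eq_bot_of_le_normalizer`).

Suppose p divides |K|. By semiprimitivity, a normal subgroup of G_v is transitive on Γ(v) or meets H
inside K_v. Together with O_p(L_x) = 1 this forces O_q(H) = 1 for every prime q, and then C_H(K) =
1. Hence K and K_v share the same `minSelfCentralizing` subgroup, in effect their socle. It is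
normalised by g and by G_v, so it is trivial, and so is K: a contradiction
(`not_dvd_card_inf_of_relPCore_le`). -/

namespace Subgroup

/-! ### Normalisers and centralisers inside an ambient group -/

variable {G : Type*} [Group G]

theorem conj_mem_of_mem_normalizer {N : Subgroup G} {g n : G} (hg : g ∈ normalizer (N : Set G))
    (hn : n ∈ N) : g * n * g⁻¹ ∈ N :=
  (mem_normalizer_iff.1 hg n).1 hn

theorem le_normalizer_of_conj_mem {S N : Subgroup G}
    (h : ∀ g ∈ S, ∀ n ∈ N, g * n * g⁻¹ ∈ N) : S ≤ normalizer (N : Set G) := by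
  intro g hg
  refine mem_normalizer_iff.2 fun n => ⟨h g hg n, fun hn => ?_⟩
  have := h g⁻¹ (S.inv_mem hg) _ hn
  simpa [mul_assoc] using this

/-- Two subgroups of `H` that are normalised by `H` and meet trivially commute. -/
theorem le_centralizer_of_inf_eq_bot {H A B : Subgroup G} (hA : A ≤ H) (hB : B ≤ H)
    (hHA : H ≤ normalizer (A : Set G)) (hHB : H ≤ normalizer (B : Set G)) (h : A ⊓ B = ⊥) :
    A ≤ centralizer (B : Set G) := by
  intro a ha
  refine mem_centralizer_iff.2 fun b hb => ?_
  have h1 : b * a * b⁻¹ * a⁻¹ ∈ A ⊓ B := by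
    refine ⟨A.mul_mem (conj_mem_of_mem_normalizer (hHA (hB hb)) ha) (A.inv_mem ha), ?_⟩
    have := B.mul_mem hb (conj_mem_of_mem_normalizer (hHB (hA ha)) (B.inv_mem hb))
    simpa [mul_assoc] using this
  rw [h, mem_bot] at h1
  have h2 : b * a * b⁻¹ = a := mul_inv_eq_one.1 h1
  exact mul_inv_eq_iff_eq_mul.1 h2

theorem normalizer_le_normalizer_centralizer (B : Subgroup G) :
    normalizer (B : Set G) ≤ normalizer (centralizer (B : Set G) : Set G) := by
  refine le_normalizer_of_conj_mem fun g hg n hn => mem_centralizer_iff.2 fun b hb => ?_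
  have hb' := conj_mem_of_mem_normalizer (inv_mem hg) hb
  have := mem_centralizer_iff.1 hn _ hb'
  simp only [inv_inv] at this
  calc b * (g * n * g⁻¹) = g * (g⁻¹ * b * g * n) * g⁻¹ := by group
    _ = g * (n * (g⁻¹ * b * g)) * g⁻¹ := by rw [this]
    _ = g * n * g⁻¹ * b := by group

theorem le_normalizer_inf {S A B : Subgroup G} (hA : S ≤ normalizer (A : Set G))
    (hB : S ≤ normalizer (B : Set G)) : S ≤ normalizer ((A ⊓ B : Subgroup G) : Set G) :=
  le_normalizer_of_conj_mem fun _ hg _ hn =>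
    ⟨conj_mem_of_mem_normalizer (hA hg) hn.1, conj_mem_of_mem_normalizer (hB hg) hn.2⟩

theorem le_normalizer_inf_centralizer {S A B : Subgroup G} (hA : S ≤ normalizer (A : Set G))
    (hB : S ≤ normalizer (B : Set G)) :
    S ≤ normalizer ((A ⊓ centralizer (B : Set G) : Subgroup G) : Set G) :=
  le_normalizer_inf hA (hB.trans (normalizer_le_normalizer_centralizer B))

/-! ### The p-core of a subgroup -/

/-- `O_p(A)` as a subgroup of the ambient group. -/
def relPCore (p : ℕ) (A : Subgroup G) : Subgroup G := (pCore p A).map A.subtype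

section relPCore

variable {p : ℕ} {A : Subgroup G}

theorem relPCore_le : relPCore p A ≤ A := map_subtype_le _

theorem isPGroup_relPCore [Fact p.Prime] : IsPGroup p (relPCore p A) :=
  (pCore_isGreatest p A).1.2.map _

theorem le_relPCore {N : Subgroup G} (hNA : N ≤ A) (hN : A ≤ normalizer (N : Set G))
    (hp : IsPGroup p N) : N ≤ relPCore p A := by
  have h1 : (N.subgroupOf A).Normal := by
    refine ⟨fun n hn a => ?_⟩
    exact conj_mem_of_mem_normalizer (N := N) (hN a.2) hn
  have h2 : IsPGroup p (N.subgroupOf A) := hp.comap_subtype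
  have h3 : N.subgroupOf A ≤ pCore p A := le_sSup ⟨h1, h2⟩
  intro n hn
  exact ⟨⟨n, hNA hn⟩, h3 hn, rfl⟩

/-- O_p(A) is characteristic in A. The normaliser form also covers elements outside A, such as an
arc-reversing automorphism of an arc stabiliser. -/
theorem normalizer_le_normalizer_relPCore [Fact p.Prime] :
    normalizer (A : Set G) ≤ normalizer (relPCore p A : Set G) := by
  refine le_normalizer_of_conj_mem fun g hg n hn => ?_
  have hle : (relPCore p A).map (MulAut.conj g).toMonoidHom ≤ relPCore p A := by
    refine le_relPCore ?_ ?_ (isPGroup_relPCore.map _)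
    · rintro _ ⟨y, hy, rfl⟩
      exact conj_mem_of_mem_normalizer hg (relPCore_le hy)
    · refine le_normalizer_of_conj_mem fun a ha => ?_
      rintro _ ⟨y, hy, rfl⟩
      have ha' := conj_mem_of_mem_normalizer (inv_mem hg) ha
      obtain ⟨⟨z, hz⟩, hz1, hz2⟩ := hy
      refine ⟨_, ⟨_, (pCore_isGreatest p A).1.1.conj_mem _ hz1 ⟨_, ha'⟩, rfl⟩, ?_⟩
      simp at hz2
      simp [hz2, mul_assoc]
  exact hle ⟨n, hn, rfl⟩

theorem le_normalizer_relPCore [Fact p.Prime] : A ≤ normalizer (relPCore p A : Set G) :=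
  le_normalizer.trans normalizer_le_normalizer_relPCore

theorem relPCore_mono_of_normal [Fact p.Prime] {B : Subgroup G} (hBA : B ≤ A)
    (hB : A ≤ normalizer (B : Set G)) : relPCore p B ≤ relPCore p A :=
  le_relPCore (relPCore_le.trans hBA) (hB.trans normalizer_le_normalizer_relPCore)
    isPGroup_relPCore

end relPCore

/-- If `O_q(A) = 1` for all primes `q`, then abelian normal subgroups of `A` are trivial. -/
theorem eq_bot_of_commute [Finite G] {A B : Subgroup G}
    (hA : ∀ q : ℕ, q.Prime → relPCore q A = ⊥) (hBA : B ≤ A) (hB : A ≤ normalizer (B : Set G))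
    (hcomm : ∀ x ∈ B, ∀ y ∈ B, x * y = y * x) : B = ⊥ := by
  by_contra hne
  have hcard : Nat.card B ≠ 1 := fun h => hne (eq_bot_of_card_eq B h)
  obtain ⟨q, hq, hdvd⟩ := Nat.exists_prime_and_dvd hcard
  have : Fact q.Prime := ⟨hq⟩
  obtain ⟨b, hb⟩ := exists_prime_orderOf_dvd_card' q hdvd
  -- The elements of B killed by q form a normal q-subgroup of A, nontrivial by Cauchy.
  let N : Subgroup G :=
    { carrier := {x | x ∈ B ∧ x ^ q = 1}
      one_mem' := ⟨B.one_mem, one_pow q⟩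
      mul_mem' := fun {x y} hx hy => ⟨B.mul_mem hx.1 hy.1, by
        rw [Commute.mul_pow (hcomm x hx.1 y hy.1), hx.2, hy.2, one_mul]⟩
      inv_mem' := fun {x} hx => ⟨B.inv_mem hx.1, by rw [inv_pow, hx.2, inv_one]⟩ }
  have hN : N ≤ relPCore q A := by
    refine le_relPCore (fun x hx => hBA hx.1) (le_normalizer_of_conj_mem fun a ha x hx =>
      ⟨conj_mem_of_mem_normalizer (hB ha) hx.1, ?_⟩) fun x => ⟨1, Subtype.ext ?_⟩
    · rw [conj_pow, hx.2]; simp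
    · simpa using x.2.2
  rw [hA q hq] at hN
  have hbN : (b : G) ∈ N := by
    refine ⟨b.2, ?_⟩
    have := pow_orderOf_eq_one b
    rw [hb] at this
    simpa using congrArg Subtype.val this
  have hb1 : b = 1 := Subtype.ext (by simpa using hN hbN)
  rw [hb1, orderOf_one] at hb
  exact hq.one_lt.ne hb

/-! ### A substitute for the socle when the soluble radical is trivial -/

/-- The intersection of all normal subgroups of `A` with trivial centraliser in `A`. -/
def minSelfCentralizing (A : Subgroup G) : Subgroup G :=
  sInf {N | N ≤ A ∧ A ≤ normalizer (N : Set G) ∧ A ⊓ centralizer (N : Set G) = ⊥}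

theorem minSelfCentralizing_le {A N : Subgroup G} (hNA : N ≤ A) (hN : A ≤ normalizer (N : Set G))
    (hc : A ⊓ centralizer (N : Set G) = ⊥) : minSelfCentralizing A ≤ N :=
  sInf_le ⟨hNA, hN, hc⟩

theorem normalizer_le_normalizer_minSelfCentralizing (A : Subgroup G) :
    normalizer (A : Set G) ≤ normalizer (minSelfCentralizing A : Set G) := by
  refine le_normalizer_of_conj_mem fun g hg n hn => ?_
  rw [minSelfCentralizing, mem_sInf] at hn ⊢
  rintro N ⟨hNA, hN, hc⟩
  refine hn (N.comap (MulAut.conj g).toMonoidHom) ⟨fun x hx => ?_, ?_, ?_⟩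
  · exact (mem_normalizer_iff.1 hg x).2 (hNA hx)
  · refine le_normalizer_of_conj_mem fun a ha x hx => ?_
    have := conj_mem_of_mem_normalizer (hN (conj_mem_of_mem_normalizer hg ha)) hx
    simp only [mem_comap, MulAut.conj_apply, MulEquiv.toMonoidHom_eq_coe,
      MonoidHom.coe_coe] at this ⊢
    convert this using 1
    group
  · rw [eq_bot_iff]
    rintro x ⟨hx1, hx2⟩
    have hmem : g * x * g⁻¹ ∈ A ⊓ centralizer (N : Set G) := by
      refine ⟨conj_mem_of_mem_normalizer hg hx1, mem_centralizer_iff.2 fun y hy => ?_⟩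
      have hy' : g⁻¹ * y * g ∈ N.comap (MulAut.conj g).toMonoidHom := by
        simpa [mul_assoc] using hy
      have := mem_centralizer_iff.1 hx2 _ hy'
      calc y * (g * x * g⁻¹) = g * (g⁻¹ * y * g * x) * g⁻¹ := by group
        _ = g * (x * (g⁻¹ * y * g)) * g⁻¹ := by rw [this]
        _ = g * x * g⁻¹ * y := by group
    rw [hc, mem_bot] at hmem
    simpa using hmem

section

variable [Finite G] {A : Subgroup G}

/-- Let Y = C_A(M ∩ N). Then Y ∩ M ∩ N is abelian and normal, hence trivial; so Y ∩ M centralises N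
and is trivial; so Y centralises M and is trivial. -/
theorem inf_centralizer_inf_eq_bot (hA : ∀ q : ℕ, q.Prime → relPCore q A = ⊥) {M N : Subgroup G}
    (hMA : M ≤ A) (hM : A ≤ normalizer (M : Set G)) (hMc : A ⊓ centralizer (M : Set G) = ⊥)
    (hNA : N ≤ A) (hN : A ≤ normalizer (N : Set G)) (hNc : A ⊓ centralizer (N : Set G) = ⊥) :
    A ⊓ centralizer ((M ⊓ N : Subgroup G) : Set G) = ⊥ := by
  have hMN := le_normalizer_inf hM hN
  set Y := A ⊓ centralizer ((M ⊓ N : Subgroup G) : Set G) with hY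
  have hYn : A ≤ normalizer (Y : Set G) := le_normalizer_inf_centralizer le_normalizer hMN
  have h1 : (Y ⊓ M) ⊓ N = ⊥ := by
    refine eq_bot_of_commute hA (fun x hx => hNA hx.2)
      (le_normalizer_inf (le_normalizer_inf hYn hM) hN) fun x hx y hy => ?_
    exact mem_centralizer_iff.1 hy.1.1.2 x ⟨hx.1.2, hx.2⟩
  have h2 : Y ⊓ M = ⊥ := by
    have := le_centralizer_of_inf_eq_bot (inf_le_right.trans hMA) hNA (le_normalizer_inf hYn hM) hN
      h1
    rw [eq_bot_iff, ← hNc]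
    exact le_inf (inf_le_right.trans hMA) this
  have := le_centralizer_of_inf_eq_bot inf_le_left hMA hYn hM h2
  rw [eq_bot_iff, ← hMc]
  exact le_inf inf_le_left this

/-- The defining family is finite, contains A and is closed under intersection, so its infimum is a
member. -/
theorem minSelfCentralizing_spec (hA : ∀ q : ℕ, q.Prime → relPCore q A = ⊥) :
    minSelfCentralizing A ≤ A ∧ A ⊓ centralizer (minSelfCentralizing A : Set G) = ⊥ := by
  set F := {N : Subgroup G | N ≤ A ∧ A ≤ normalizer (N : Set G) ∧
    A ⊓ centralizer (N : Set G) = ⊥} with hF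
  have hAF : A ∈ F := by
    refine ⟨le_rfl, le_normalizer, eq_bot_of_commute hA inf_le_left
      (le_normalizer_inf_centralizer le_normalizer le_normalizer) fun x hx y hy => ?_⟩
    exact mem_centralizer_iff.1 hy.2 x hx.1
  obtain ⟨M, hM⟩ := F.toFinite.exists_minimal ⟨A, hAF⟩
  have hMF := hM.1
  have hmin : minSelfCentralizing A = M := by
    refine le_antisymm (sInf_le hMF) (le_sInf fun N hN => ?_)
    have hMN : M ⊓ N ∈ F := ⟨inf_le_left.trans hMF.1, le_normalizer_inf hMF.2.1 hN.2.1,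
      inf_centralizer_inf_eq_bot hA hMF.1 hMF.2.1 hMF.2.2 hN.1 hN.2.1 hN.2.2⟩
    exact (hM.2 hMN inf_le_left).trans inf_le_right
  rw [hmin]
  exact ⟨hMF.1, hMF.2.2⟩

/-- Each side belongs to the family defining the other. For the harder half, the centraliser in A of
the subgroup attached to K meets K trivially, hence centralises K, hence is trivial. -/
theorem minSelfCentralizing_eq_of_normal {K : Subgroup G}
    (hA : ∀ q : ℕ, q.Prime → relPCore q A = ⊥) (hK : ∀ q : ℕ, q.Prime → relPCore q K = ⊥)
    (hKA : K ≤ A) (hKn : A ≤ normalizer (K : Set G)) (hKc : A ⊓ centralizer (K : Set G) = ⊥) :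
    minSelfCentralizing K = minSelfCentralizing A := by
  obtain ⟨hXK, hXKc⟩ := minSelfCentralizing_spec hK
  obtain ⟨hXA, hXAc⟩ := minSelfCentralizing_spec hA
  have hXKn := hKn.trans (normalizer_le_normalizer_minSelfCentralizing K)
  have hXAn := (le_normalizer (H := A)).trans (normalizer_le_normalizer_minSelfCentralizing A)
  have hle := minSelfCentralizing_le hKA hKn hKc
  refine le_antisymm (minSelfCentralizing_le hle (hKA.trans hXAn) ?_)
    (minSelfCentralizing_le (hXK.trans hKA) hXKn ?_)
  · rw [eq_bot_iff, ← hXAc]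
    exact inf_le_inf_right _ hKA
  · set Y := A ⊓ centralizer (minSelfCentralizing K : Set G)
    have hY : Y ⊓ K = ⊥ := by
      rw [eq_bot_iff, ← hXKc]
      exact le_inf inf_le_right (inf_le_left.trans inf_le_right)
    have := le_centralizer_of_inf_eq_bot inf_le_left hKA
      (le_normalizer_inf_centralizer le_normalizer hXKn) hKn hY
    rw [eq_bot_iff, ← hKc]
    exact le_inf inf_le_left this

end

/-! ### Subgroups generated by p-elements -/

/-- `O^{p'}(A)`: the subgroup generated by the elements of `p`-power order of `A`. -/
def pElementsClosure (p : ℕ) (A : Subgroup G) : Subgroup G :=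
  closure {t | t ∈ A ∧ ∃ n : ℕ, t ^ p ^ n = 1}

/-- Only conjugates of p-elements need to stay in A: g is not assumed to normalise A. -/
theorem conj_mem_pElementsClosure {p : ℕ} {A : Subgroup G} {g : G}
    (hg : ∀ t ∈ A, ∀ n : ℕ, t ^ p ^ n = 1 → g * t * g⁻¹ ∈ A) :
    ∀ t ∈ pElementsClosure p A, g * t * g⁻¹ ∈ pElementsClosure p A := by
  have : pElementsClosure p A ≤ (pElementsClosure p A).comap (MulAut.conj g).toMonoidHom := by
    refine (closure_le _).2 ?_
    rintro t ⟨ht, n, hn⟩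
    refine subset_closure ⟨hg t ht n hn, n, ?_⟩
    simp [conj_pow, hn]
  exact fun t ht => this ht

theorem pElementsClosure_le {p : ℕ} {A : Subgroup G} : pElementsClosure p A ≤ A :=
  (closure_le _).2 fun _ ht => ht.1

theorem normalizer_le_normalizer_pElementsClosure (p : ℕ) (A : Subgroup G) :
    normalizer (A : Set G) ≤ normalizer (pElementsClosure p A : Set G) :=
  le_normalizer_of_conj_mem fun _ hg => conj_mem_pElementsClosure fun _ ht _ _ =>
    conj_mem_of_mem_normalizer hg ht

theorem pElementsClosure_ne_bot [Finite G] {p : ℕ} (hp : p.Prime) {A : Subgroup G}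
    (hA : p ∣ Nat.card A) : pElementsClosure p A ≠ ⊥ := by
  have : Fact p.Prime := ⟨hp⟩
  obtain ⟨b, hb⟩ := exists_prime_orderOf_dvd_card' p hA
  intro h
  have hbN : (b : G) ∈ pElementsClosure p A := by
    refine subset_closure ⟨b.2, 1, ?_⟩
    have := pow_orderOf_eq_one b
    rw [hb] at this
    simpa using congrArg Subtype.val this
  have hb1 : b = 1 := Subtype.ext (by simpa [h] using hbN)
  rw [hb1, orderOf_one] at hb
  exact hp.one_lt.ne hb

/-- In a group with normal subgroup `K`, a `p`-element in the coset `c K` of a `q`-element `c`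
lies in `K`. -/
theorem mul_mem_of_coprime_pow {p q m n : ℕ} (hpq : p.Coprime q) {A K : Subgroup G}
    (hK : A ≤ normalizer (K : Set G)) {c t : G} (hc : c ∈ A) (ht : t ∈ K)
    (hcq : c ^ q ^ m = 1) (hctp : (c * t) ^ p ^ n = 1) : c * t ∈ K := by
  -- Modulo K, the k-th powers of c * t and c agree; k = q ^ m puts (c * t) ^ q ^ m in K, and c * t
  -- is a power of that element.
  have hpow : ∀ k : ℕ, (c ^ k)⁻¹ * (c * t) ^ k ∈ K := by
    intro k
    induction k with
    | zero => simp
    | succ k ih =>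
      have h1 := conj_mem_of_mem_normalizer (hK (A.inv_mem hc)) ih
      have h2 := K.mul_mem h1 ht
      convert h2 using 1
      rw [pow_succ, pow_succ]
      group
  have h1 := hpow (q ^ m)
  rw [hcq, inv_one, one_mul] at h1
  have hcop : (p ^ n).Coprime (q ^ m) := hpq.pow n m
  have h2 : orderOf (c * t) ∣ p ^ n := orderOf_dvd_of_pow_eq_one hctp
  obtain ⟨k, hk⟩ := exists_pow_eq_self_of_coprime (Nat.Coprime.coprime_dvd_left h2 hcop).symm
  rw [← hk]
  exact K.pow_mem h1 k

/-! ### The group-theoretic core of the argument -/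

/-- A Thompson-Wielandt type criterion. Here `Gv` plays the role of a vertex stabiliser, `H` of an
arc stabiliser, `Kv` and `Ku` of the kernels of the two local actions, and `g` of an automorphism
reversing the arc. -/
theorem not_dvd_card_inf_of_relPCore_le [Finite G] {p : ℕ} (hp : p.Prime)
    {Gv H Kv Ku : Subgroup G} {g : G} (hHG : H ≤ Gv) (hKH : Kv ≤ H)
    (hKn : Gv ≤ normalizer (Kv : Set G)) (hgH : g ∈ normalizer (H : Set G))
    (hvu : ∀ x, x ∈ Kv ↔ g * x * g⁻¹ ∈ Ku) (huv : ∀ x, x ∈ Ku ↔ g * x * g⁻¹ ∈ Kv)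
    (hcore : ∀ N ≤ H, Gv ≤ normalizer (N : Set G) → g ∈ normalizer (N : Set G) → N = ⊥)
    (hsemi : ∀ M ≤ Gv, Gv ≤ normalizer (M : Set G) →
      (∀ a ∈ Gv, ∃ h ∈ H, ∃ m ∈ M, a = h * m) ∨ M ⊓ H ≤ Kv)
    (hpc : relPCore p H ≤ Kv) : ¬ p ∣ Nat.card (Kv ⊓ Ku : Subgroup G) := by
  intro hdvd
  have hHKv : H ≤ normalizer (Kv : Set G) := hHG.trans hKn
  have hKuH : Ku ≤ H := fun x hx => (mem_normalizer_iff.1 hgH x).2 (hKH ((huv x).1 hx))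
  have hHKu : H ≤ normalizer (Ku : Set G) := by
    refine le_normalizer_of_conj_mem fun a ha x hx => (huv _).2 ?_
    have := conj_mem_of_mem_normalizer (hHKv (conj_mem_of_mem_normalizer hgH ha)) ((huv x).1 hx)
    convert this using 1
    group
  set K := Kv ⊓ Ku with hKdef
  have hHK : H ≤ normalizer (K : Set G) := le_normalizer_inf hHKv hHKu
  have hKK : K ≤ H := inf_le_left.trans hKH
  have hgK : g ∈ normalizer (K : Set G) :=
    mem_normalizer_iff.2 fun x => ⟨fun hx => ⟨(huv x).1 hx.2, (hvu x).1 hx.1⟩,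
      fun hx => ⟨(hvu x).2 hx.2, (huv x).2 hx.1⟩⟩
  have hKne : K ≠ ⊥ := by
    intro h
    rw [h, card_bot] at hdvd
    exact hp.one_lt.ne' (Nat.dvd_one.1 hdvd)
  have hnormal : ∀ M : Subgroup G, (∀ a ∈ Gv, ∃ h ∈ H, ∃ m ∈ M, a = h * m) →
      ∀ N : Subgroup G, H ≤ normalizer (N : Set G) → M ≤ normalizer (N : Set G) →
      Gv ≤ normalizer (N : Set G) := by
    intro M hM N hN hMN a ha
    obtain ⟨h, hh, m, hm, rfl⟩ := hM a ha
    exact mul_mem (hN hh) (hMN hm)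
  -- Once inside K_v, O_q(H) equals O_q(K_v), so both G_v and g normalise it.
  have hcoreP : ∀ q : ℕ, q.Prime → relPCore q H ≤ Kv → relPCore q H = ⊥ := by
    intro q hq hle
    have : Fact q.Prime := ⟨hq⟩
    have heq : relPCore q H = relPCore q Kv :=
      le_antisymm (le_relPCore hle (hKH.trans le_normalizer_relPCore) isPGroup_relPCore)
        (relPCore_mono_of_normal hKH hHKv)
    refine hcore _ relPCore_le ?_ (normalizer_le_normalizer_relPCore hgH)
    rw [heq]
    exact hKn.trans normalizer_le_normalizer_relPCore
  have hO : ∀ q : ℕ, q.Prime → relPCore q H = ⊥ := by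
    intro q hq
    obtain rfl | hqp := eq_or_ne q p
    · exact hcoreP q hq hpc
    refine hcoreP q hq ?_
    have : Fact q.Prime := ⟨hq⟩
    set T := pElementsClosure p K with hT
    have hTn := normalizer_le_normalizer_pElementsClosure p K
    -- M is the G_v-core of the normaliser of T in G_v. If M is transitive then G_v = HM normalises
    -- T, which `hcore` forbids; otherwise O_q(H) ≤ M ∩ H ≤ K_v.
    let M : Subgroup G :=
      { carrier := {m | m ∈ Gv ∧ ∀ b ∈ Gv, b⁻¹ * m * b ∈ normalizer (T : Set G)}
        one_mem' := ⟨one_mem _, fun b _ => by simp⟩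
        mul_mem' := fun {x y} hx hy => ⟨mul_mem hx.1 hy.1, fun b hb => by
          have := mul_mem (hx.2 b hb) (hy.2 b hb)
          simpa [mul_assoc] using this⟩
        inv_mem' := fun {x} hx => ⟨inv_mem hx.1, fun b hb => by
          have := inv_mem (hx.2 b hb)
          simpa [mul_assoc] using this⟩ }
    have hMG : M ≤ Gv := fun m hm => hm.1
    have hMn : Gv ≤ normalizer (M : Set G) := by
      refine le_normalizer_of_conj_mem fun a ha m hm =>
        ⟨mul_mem (mul_mem ha hm.1) (inv_mem ha), fun b hb => ?_⟩
      have := hm.2 (a⁻¹ * b) (mul_mem (inv_mem ha) hb)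
      simpa [mul_assoc] using this
    have hPM : relPCore q H ≤ M := by
      intro m hm
      -- Conjugating t multiplies it by a conjugate of the commutator [m, s], a q-element of K_v.
      -- The product is a p-element, so `mul_mem_of_coprime_pow` puts it in K.
      have hstep : ∀ m ∈ relPCore q H, ∀ b ∈ Gv, ∀ t ∈ K, ∀ n : ℕ, t ^ p ^ n = 1 →
          (b⁻¹ * m * b) * t * (b⁻¹ * m * b)⁻¹ ∈ K := by
        intro m hm b hb t ht n htn
        set s := b * t * b⁻¹ with hs
        have hsK : s ∈ Kv := conj_mem_of_mem_normalizer (hKn hb) ht.1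
        have hcP : m * s * m⁻¹ * s⁻¹ ∈ relPCore q H := by
          have := mul_mem hm
            (conj_mem_of_mem_normalizer (le_normalizer_relPCore (hKH hsK)) (inv_mem hm))
          simpa [mul_assoc] using this
        have hcK : m * s * m⁻¹ * s⁻¹ ∈ Kv :=
          mul_mem (conj_mem_of_mem_normalizer (hHKv (relPCore_le hm)) hsK) (inv_mem hsK)
        obtain ⟨k, hk⟩ := isPGroup_relPCore ⟨_, hcP⟩
        have hk' : (m * s * m⁻¹ * s⁻¹) ^ q ^ k = 1 := by simpa using congrArg Subtype.val hk
        have hcb := conj_mem_of_mem_normalizer (hKn (inv_mem hb)) hcK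
        have hKKv : Kv ≤ normalizer (K : Set G) := hKH.trans hHK
        have heq : (b⁻¹ * m * b) * t * (b⁻¹ * m * b)⁻¹ =
            b⁻¹ * (m * s * m⁻¹ * s⁻¹) * b⁻¹⁻¹ * t := by rw [hs]; group
        rw [heq]
        refine mul_mem_of_coprime_pow (p := p) (q := q) (m := k) (n := n)
          ((Nat.coprime_primes hp hq).2 hqp.symm) hKKv hcb ht ?_ ?_
        · rw [conj_pow, hk']; simp
        · rw [← heq, conj_pow, htn]; simp
      refine ⟨hHG (relPCore_le hm), fun b hb => ?_⟩
      have hle : (relPCore q H).map (MulAut.conj b⁻¹).toMonoidHom ≤ normalizer (T : Set G) := by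
        refine le_normalizer_of_conj_mem ?_
        rintro _ ⟨y, hy, rfl⟩
        have := conj_mem_pElementsClosure (g := b⁻¹ * y * b) (hstep y hy b hb)
        simpa [mul_assoc] using this
      exact hle ⟨m, hm, by simp⟩
    rcases hsemi M hMG hMn with h | h
    · exfalso
      refine pElementsClosure_ne_bot hp hdvd (hcore T (pElementsClosure_le.trans hKK)
        (hnormal M h T (hHK.trans hTn) fun m hm => ?_) (hTn hgK))
      simpa using hm.2 1 (one_mem _)
    · exact (le_inf hPM relPCore_le).trans h
  have hON : ∀ A : Subgroup G, A ≤ H → H ≤ normalizer (A : Set G) →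
      ∀ q : ℕ, q.Prime → relPCore q A = ⊥ := by
    intro A hA hAn q hq
    have : Fact q.Prime := ⟨hq⟩
    rw [eq_bot_iff, ← hO q hq]
    exact relPCore_mono_of_normal hA hAn
  -- If C_{G_v}(K_v) were transitive, then G_v would normalise K, since K ≤ K_v; otherwise C_H(K_v)
  -- lies in K_v and is abelian.
  have hCKv : H ⊓ centralizer (Kv : Set G) = ⊥ := by
    rcases hsemi (Gv ⊓ centralizer (Kv : Set G)) inf_le_left
      (le_normalizer_inf_centralizer le_normalizer hKn) with h | h
    · refine absurd (hcore K hKK (hnormal _ h K hHK fun m hm => ?_) hgK) hKne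
      have hm' := centralizer_le (show (K : Set G) ⊆ Kv from fun x hx => hx.1) hm.2
      exact centralizer_le_normalizer _ hm'
    · have hle : H ⊓ centralizer (Kv : Set G) ≤ Kv :=
        (le_inf (le_inf (inf_le_left.trans hHG) inf_le_right) inf_le_left).trans h
      refine eq_bot_of_commute hO inf_le_left
        (le_normalizer_inf_centralizer le_normalizer hHKv) fun x hx y hy => ?_
      exact mem_centralizer_iff.1 hy.2 x (hle hx)
  have hCKu : H ⊓ centralizer (Ku : Set G) = ⊥ := by
    rw [eq_bot_iff]
    rintro x ⟨hx, hxc⟩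
    have hmem : g * x * g⁻¹ ∈ H ⊓ centralizer (Kv : Set G) := by
      refine ⟨conj_mem_of_mem_normalizer hgH hx, mem_centralizer_iff.2 fun y hy => ?_⟩
      have hy' : g⁻¹ * y * g ∈ Ku := (huv _).2 (by simpa [mul_assoc] using hy)
      have := mem_centralizer_iff.1 hxc _ hy'
      calc y * (g * x * g⁻¹) = g * (g⁻¹ * y * g * x) * g⁻¹ := by group
        _ = g * (x * (g⁻¹ * y * g)) * g⁻¹ := by rw [this]
        _ = g * x * g⁻¹ * y := by group
    rw [hCKv, mem_bot] at hmem
    simpa using hmem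
  have hCK : H ⊓ centralizer (K : Set G) = ⊥ := by
    set Y := H ⊓ centralizer (K : Set G)
    have hYn : H ≤ normalizer (Y : Set G) := le_normalizer_inf_centralizer le_normalizer hHK
    have h1 : (Y ⊓ Kv) ⊓ Ku = ⊥ := by
      refine eq_bot_of_commute hO (fun x hx => hKuH hx.2)
        (le_normalizer_inf (le_normalizer_inf hYn hHKv) hHKu) fun x hx y hy => ?_
      exact mem_centralizer_iff.1 hy.1.1.2 x ⟨hx.1.2, hx.2⟩
    have h2 : Y ⊓ Kv = ⊥ := by
      rw [eq_bot_iff, ← hCKu]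
      exact le_inf (inf_le_right.trans hKH) (le_centralizer_of_inf_eq_bot
        (inf_le_right.trans hKH) hKuH (le_normalizer_inf hYn hHKv) hHKu h1)
    rw [eq_bot_iff, ← hCKv]
    exact le_inf inf_le_left (le_centralizer_of_inf_eq_bot inf_le_left hKH hYn hHKv h2)
  have hX : minSelfCentralizing K = minSelfCentralizing Kv :=
    minSelfCentralizing_eq_of_normal (hON Kv hKH hHKv) (hON K hKK hHK) inf_le_left (hKH.trans hHK)
      (by rw [eq_bot_iff, ← hCK]; exact inf_le_inf_right _ hKH)
  obtain ⟨hXK, hXc⟩ := minSelfCentralizing_spec (hON K hKK hHK)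
  have hXbot : minSelfCentralizing K = ⊥ := by
    refine hcore _ (hXK.trans hKK) ?_ (normalizer_le_normalizer_minSelfCentralizing K hgK)
    rw [hX]
    exact hKn.trans (normalizer_le_normalizer_minSelfCentralizing Kv)
  rw [hXbot] at hXc
  refine hKne (eq_bot_iff.2 fun x hx => ?_)
  rw [← hXc]
  exact ⟨hx, mem_centralizer_iff.2 fun y hy => by simp [mem_bot.1 hy]⟩

end Subgroup

open MulAction

/-! ### From locally-L pairs to the criterion -/

section LocalAction

variable {V : Type*} {Γ : SimpleGraph V} (G : Subgroup (Γ ≃g Γ))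

theorem smul_adj_smul_iff (a : G) {v w : V} : Γ.Adj (a • v) (a • w) ↔ Γ.Adj v w :=
  a.1.map_adj_iff

/-- The kernel `G_v^{[1]}` of the action of `G_v` on the neighbourhood of `v`. -/
def ballStabilizer (v : V) : Subgroup G where
  carrier := {a | a • v = v ∧ ∀ w, Γ.Adj v w → a • w = w}
  one_mem' := ⟨one_smul _ _, fun _ _ => one_smul _ _⟩
  mul_mem' := fun {a b} ha hb => ⟨by rw [mul_smul, hb.1, ha.1], fun w hw => by
    rw [mul_smul, hb.2 w hw, ha.2 w hw]⟩
  inv_mem' := fun {a} ha => ⟨inv_smul_eq_iff.2 ha.1.symm, fun w hw =>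
    inv_smul_eq_iff.2 (ha.2 w hw).symm⟩

theorem conj_mem_ballStabilizer {v : V} {a b : G} (ha : a ∈ ballStabilizer G v) :
    b * a * b⁻¹ ∈ ballStabilizer G (b • v) := by
  refine ⟨by simp [mul_smul, ha.1], fun w hw => ?_⟩
  have hw' : Γ.Adj v (b⁻¹ • w) := by
    rw [← smul_adj_smul_iff G b]; simpa using hw
  rw [mul_smul, mul_smul, ha.2 _ hw', smul_inv_smul]

theorem conj_mem_ballStabilizer_iff {v : V} {a b : G} :
    a ∈ ballStabilizer G v ↔ b * a * b⁻¹ ∈ ballStabilizer G (b • v) := by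
  refine ⟨fun h => conj_mem_ballStabilizer G h, fun h => ?_⟩
  have := conj_mem_ballStabilizer G (b := b⁻¹) h
  simpa [mul_assoc] using this

theorem conj_mem_stabilizer_iff {v : V} {a b : G} :
    a ∈ stabilizer G v ↔ b * a * b⁻¹ ∈ stabilizer G (b • v) := by
  simp [mem_stabilizer_iff, mul_smul]

/-- A permutation isomorphism from `L` to `G_v^{Γ(v)}` gives an epimorphism `G_v → L` compatible
with the bijection between `Ω` and the neighbourhood of `v`. -/
theorem PermIsomorphic.exists_hom {Ω : Type*} {L : Subgroup (Equiv.Perm Ω)} {v : V}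
    (h : PermIsomorphic L (localAction G v)) :
    ∃ (e : Ω ≃ Γ.neighborSet v) (φ : stabilizer G v →* L), Function.Surjective φ ∧
      ∀ (a : stabilizer G v) (ω : Ω), (e (φ a • ω) : V) = (a : G) • (e ω : V) := by
  obtain ⟨e, he⟩ := h
  change _ = (localHom G v).range at he
  let ψ := (L.equivMapOfInjective e.permCongrHom.toMonoidHom e.permCongrHom.injective).trans
    (MulEquiv.subgroupCongr he)
  refine ⟨e, ψ.symm.toMonoidHom.comp (localHom G v).rangeRestrict, ?_, fun a ω => ?_⟩
  · exact ψ.symm.surjective.comp (localHom G v).rangeRestrict_surjective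
  · have h1 : (ψ (ψ.symm ((localHom G v).rangeRestrict a)) : Equiv.Perm (Γ.neighborSet v)) =
        localHom G v a := by rw [ψ.apply_symm_apply]; rfl
    have h2 := congrArg (fun σ : Equiv.Perm (Γ.neighborSet v) => (σ (e ω) : V)) h1
    have h3 : e ((ψ.symm ((localHom G v).rangeRestrict a) : L) • ω) =
        (ψ (ψ.symm ((localHom G v).rangeRestrict a)) : Equiv.Perm (Γ.neighborSet v)) (e ω) := by
      change _ = e.permCongr _ (e ω)
      simp [Equiv.permCongr_apply]
      rfl
    exact (congrArg Subtype.val h3).trans h2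

section

variable {G} {Ω : Type*} {L : Subgroup (Equiv.Perm Ω)} {v : V} {e : Ω ≃ Γ.neighborSet v}
  {φ : stabilizer G v →* L}

theorem mem_ballStabilizer_iff_of_hom
    (hφ : ∀ (a : stabilizer G v) (ω : Ω), (e (φ a • ω) : V) = (a : G) • (e ω : V))
    (a : stabilizer G v) : (a : G) ∈ ballStabilizer G v ↔ φ a = 1 := by
  constructor
  · intro h
    refine Subtype.ext (Equiv.ext fun ω => e.injective (Subtype.ext ?_))
    exact (hφ a ω).trans (h.2 _ (e ω).2)
  · intro h
    refine ⟨a.2, fun w hw => ?_⟩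
    have := hφ a (e.symm ⟨w, hw⟩)
    rw [h, one_smul] at this
    simpa using this.symm

theorem mem_stabilizer_iff_of_hom
    (hφ : ∀ (a : stabilizer G v) (ω : Ω), (e (φ a • ω) : V) = (a : G) • (e ω : V))
    (a : stabilizer G v) (ω : Ω) :
    (a : G) ∈ stabilizer G (e ω : V) ↔ φ a ∈ stabilizer L ω := by
  rw [mem_stabilizer_iff, mem_stabilizer_iff, ← hφ]
  exact ⟨fun h => e.injective (Subtype.ext h), fun h => by rw [h]⟩

theorem exists_smul_eq_of_adj [IsPretransitive L Ω] (hsurj : Function.Surjective φ)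
    (hφ : ∀ (a : stabilizer G v) (ω : Ω), (e (φ a • ω) : V) = (a : G) • (e ω : V))
    {u w : V} (hu : Γ.Adj v u) (hw : Γ.Adj v w) : ∃ b ∈ stabilizer G v, b • u = w := by
  obtain ⟨l, hl⟩ := exists_smul_eq L (e.symm ⟨u, hu⟩) (e.symm ⟨w, hw⟩)
  obtain ⟨b, rfl⟩ := hsurj l
  refine ⟨b, b.2, ?_⟩
  have := hφ b (e.symm ⟨u, hu⟩)
  rw [hl] at this
  simpa using this.symm

/-- If `G_v` is transitive on `Γ(v)` and `g` reverses the arc `(v, u)`, then a subgroup of `G_v`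
normalised by `G_v` and `g` is trivial. -/
theorem eq_bot_of_le_normalizer (hΓ : Γ.Connected) {u : V} {g : G} (hgv : g • v = u)
    (htrans : ∀ w, Γ.Adj v w → ∃ b ∈ stabilizer G v, b • u = w)
    {N : Subgroup G} (hN : N ≤ stabilizer G v)
    (hvN : stabilizer G v ≤ Subgroup.normalizer (N : Set G))
    (hgN : g ∈ Subgroup.normalizer (N : Set G)) : N = ⊥ := by
  -- The orbit of v under the normaliser of N is closed under adjacency, since b * g moves v to any
  -- prescribed neighbour. So N fixes every vertex.
  have key : ∀ {s t : V}, Γ.Walk s t →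
      (∃ a ∈ Subgroup.normalizer (N : Set G), a • v = s) →
      ∃ a ∈ Subgroup.normalizer (N : Set G), a • v = t := by
    intro s t W
    induction W with
    | nil => exact id
    | @cons s s' t hadj _ ih =>
      rintro ⟨a, ha, rfl⟩
      apply ih
      have hadj' : Γ.Adj v (a⁻¹ • s') := by
        rw [← smul_adj_smul_iff G a]; simpa using hadj
      obtain ⟨b, hb, hbu⟩ := htrans _ hadj'
      refine ⟨a * b * g, mul_mem (mul_mem ha (hvN hb)) hgN, ?_⟩
      rw [mul_smul, mul_smul, hgv, hbu, smul_inv_smul]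
  refine (Subgroup.eq_bot_iff_forall _).2 fun n hn => Subtype.ext (RelIso.ext fun w => ?_)
  obtain ⟨W⟩ := hΓ.preconnected v w
  obtain ⟨a, ha, rfl⟩ := key W ⟨1, one_mem _, one_smul _ _⟩
  have h1 : a⁻¹ * n * a⁻¹⁻¹ ∈ stabilizer G v :=
    hN (Subgroup.conj_mem_of_mem_normalizer (inv_mem ha) hn)
  have h2 : n • (a • v) = a • v := by
    have : (a⁻¹ * n * a⁻¹⁻¹) • v = v := h1
    rw [inv_inv, mul_smul, mul_smul, inv_smul_eq_iff] at this
    exact this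
  exact h2

/-- The local form of semiprimitivity for normal subgroups of a vertex stabiliser. -/
theorem IsSemiprimitive.transitive_or_le_ballStabilizer (hL : IsSemiprimitive L)
    (hsurj : Function.Surjective φ)
    (hφ : ∀ (a : stabilizer G v) (ω : Ω), (e (φ a • ω) : V) = (a : G) • (e ω : V)) (ω : Ω)
    {M : Subgroup G}
    (hMn : stabilizer G v ≤ Subgroup.normalizer (M : Set G)) :
    (∀ a ∈ stabilizer G v, ∃ h ∈ stabilizer G v ⊓ stabilizer G (e ω : V), ∃ m ∈ M, a = h * m) ∨
      M ⊓ (stabilizer G v ⊓ stabilizer G (e ω : V)) ≤ ballStabilizer G v := by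
  have hn : ((M.subgroupOf (stabilizer G v)).map φ).Normal := by
    have : (M.subgroupOf (stabilizer G v)).Normal :=
      ⟨fun n hn a => Subgroup.conj_mem_of_mem_normalizer (N := M) (hMn a.2) hn⟩
    exact this.map φ hsurj
  -- Transitivity of the image of M gives a Frattini factorisation of G_v; semiregularity makes
  -- elements of M fixing `e ω` act trivially on Γ(v).
  rcases hL.2 _ hn with h | h
  · left
    intro a ha
    obtain ⟨⟨_, m, hm, rfl⟩, hl⟩ := exists_smul_eq ((M.subgroupOf (stabilizer G v)).map φ) ω
      ((φ ⟨a, ha⟩)⁻¹ • ω)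
    replace hl : φ m • ω = (φ ⟨a, ha⟩)⁻¹ • ω := hl
    have h1 : φ (⟨a, ha⟩ * m) ∈ stabilizer L ω := by
      rw [mem_stabilizer_iff, map_mul, mul_smul, hl, smul_inv_smul]
    refine ⟨a * m, ⟨mul_mem ha m.2, (mem_stabilizer_iff_of_hom hφ _ _).2 h1⟩, (m : G)⁻¹,
      inv_mem hm, by group⟩
  · right
    rintro m ⟨hm, hmv, hmu⟩
    have h1 := (mem_stabilizer_iff_of_hom hφ ⟨m, hmv⟩ ω).1 hmu
    refine (mem_ballStabilizer_iff_of_hom hφ ⟨m, hmv⟩).2 ?_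
    have h2 : (⟨φ ⟨m, hmv⟩, ⟨m, hmv⟩, hm, rfl⟩ : (M.subgroupOf (stabilizer G v)).map φ) ∈
        stabilizer ((M.subgroupOf (stabilizer G v)).map φ) ω := h1
    rw [h ω, Subgroup.mem_bot] at h2
    exact congrArg Subtype.val h2

/-- The arc stabiliser is the full preimage of L_ω under φ, so its p-core maps to a normal
p-subgroup of L_ω. This is where O_p(L_ω) = 1 enters. -/
theorem relPCore_le_ballStabilizer {p : ℕ} [Fact p.Prime] (hsurj : Function.Surjective φ)
    (hφ : ∀ (a : stabilizer G v) (ω : Ω), (e (φ a • ω) : V) = (a : G) • (e ω : V)) {ω : Ω}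
    (hω : pCore p (stabilizer L ω) = ⊥) :
    Subgroup.relPCore p (stabilizer G v ⊓ stabilizer G (e ω : V)) ≤ ballStabilizer G v := by
  set H := stabilizer G v ⊓ stabilizer G (e ω : V) with hH
  set P := Subgroup.relPCore p H with hP
  have hPH : P ≤ H := Subgroup.relPCore_le
  set N := ((P.subgroupOf (stabilizer G v)).map φ).subgroupOf (stabilizer L ω) with hN
  have hNn : N.Normal := by
    refine ⟨fun n hn l => ?_⟩
    obtain ⟨a, ha⟩ := hsurj l
    obtain ⟨m, hm, hmn⟩ := hn
    refine ⟨a * m * a⁻¹, ?_, ?_⟩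
    · refine Subgroup.conj_mem_of_mem_normalizer (N := P)
        (Subgroup.le_normalizer_relPCore ⟨a.2, ?_⟩) hm
      exact (mem_stabilizer_iff_of_hom hφ a ω).2 (ha ▸ l.2)
    · simp only [map_mul, map_inv, ha, hmn]
      rfl
  have hNp : IsPGroup p N :=
    ((Subgroup.isPGroup_relPCore.comap_subtype).map φ).comap_subtype
  have hbot : N = ⊥ := by
    rw [eq_bot_iff, ← hω]
    exact le_sSup ⟨hNn, hNp⟩
  intro a ha
  have haH := hPH ha
  refine (mem_ballStabilizer_iff_of_hom hφ ⟨a, haH.1⟩).2 ?_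
  have h1 : (⟨φ ⟨a, haH.1⟩, (mem_stabilizer_iff_of_hom hφ ⟨a, haH.1⟩ ω).1 haH.2⟩ :
      stabilizer L ω) ∈ N := ⟨⟨a, haH.1⟩, ha, rfl⟩
  rw [hbot, Subgroup.mem_bot] at h1
  exact congrArg Subtype.val h1

theorem relIndex_ballStabilizer_le [Finite Ω]
    (hφ : ∀ (a : stabilizer G v) (ω : Ω), (e (φ a • ω) : V) = (a : G) • (e ω : V)) :
    (ballStabilizer G v).relIndex (stabilizer G v) ≤ Nat.card L := by
  have h : (ballStabilizer G v).subgroupOf (stabilizer G v) = φ.ker :=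
    Subgroup.ext fun a => mem_ballStabilizer_iff_of_hom hφ a
  rw [Subgroup.relIndex, h, Subgroup.index_ker]
  exact Subgroup.card_le_card_group _

theorem ordProj_card_inf_stabilizer_le [Finite V] {p : ℕ} (hp : p.Prime)
    (hL : IsSemiprimitive L) (hΓ : Γ.Connected) (hG : IsPretransitive G V)
    (hsurj : Function.Surjective φ)
    (hφ : ∀ (a : stabilizer G v) (ω : Ω), (e (φ a • ω) : V) = (a : G) • (e ω : V)) {ω : Ω}
    (hω : pCore p (stabilizer L ω) = ⊥) :
    p ^ (Nat.card (stabilizer G v ⊓ stabilizer G (e ω : V) : Subgroup G)).factorization p ≤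
      Nat.card L * Nat.card L := by
  have : Fact p.Prime := ⟨hp⟩
  have := hL.1
  have : Finite Ω := Finite.of_equiv _ e.symm
  have : Finite (Γ ≃g Γ) := DFunLike.finite _
  set u : V := (e ω).1
  have huv : Γ.Adj v u := (e ω).2
  have htrans : ∀ w, Γ.Adj v w → ∃ b ∈ stabilizer G v, b • u = w := fun w hw =>
    exists_smul_eq_of_adj hsurj hφ huv hw
  -- Take h sending v to u, and correct it by b in G_v sending u to the neighbour h⁻¹ • v.
  obtain ⟨g, hgv, hgu⟩ : ∃ g : G, g • v = u ∧ g • u = v := by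
    obtain ⟨h, hh⟩ := exists_smul_eq G v u
    have hadj : Γ.Adj v (h⁻¹ • v) := by
      rw [← smul_adj_smul_iff G h, hh, smul_inv_smul]; exact huv.symm
    obtain ⟨b, hb, hbu⟩ := htrans _ hadj
    exact ⟨h * b, by rw [mul_smul, mem_stabilizer_iff.1 hb, hh],
      by rw [mul_smul, hbu, smul_inv_smul]⟩
  set H := stabilizer G v ⊓ stabilizer G u
  set Kv := ballStabilizer G v
  set Ku := ballStabilizer G u
  have hKvH : Kv ≤ H := fun a ha => ⟨ha.1, ha.2 u huv⟩
  have hKuH : Ku ≤ H := fun a ha => ⟨ha.2 v huv.symm, ha.1⟩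
  have hvu : ∀ a, a ∈ Kv ↔ g * a * g⁻¹ ∈ Ku := fun a => by
    have := conj_mem_ballStabilizer_iff G (v := v) (a := a) (b := g)
    rwa [hgv] at this
  have huv' : ∀ a, a ∈ Ku ↔ g * a * g⁻¹ ∈ Kv := fun a => by
    have := conj_mem_ballStabilizer_iff G (v := u) (a := a) (b := g)
    rwa [hgu] at this
  have hgH : g ∈ Subgroup.normalizer (H : Set G) := by
    refine Subgroup.mem_normalizer_iff.2 fun a => ?_
    have h1 := conj_mem_stabilizer_iff G (v := v) (a := a) (b := g)
    have h2 := conj_mem_stabilizer_iff G (v := u) (a := a) (b := g)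
    rw [hgv] at h1
    rw [hgu] at h2
    rw [Subgroup.mem_inf, Subgroup.mem_inf, h1, h2, and_comm]
  have hndvd : ¬ p ∣ Nat.card (Kv ⊓ Ku : Subgroup G) := by
    refine Subgroup.not_dvd_card_inf_of_relPCore_le hp (Gv := stabilizer G v) (H := H) (g := g)
      inf_le_left hKvH ?_ hgH hvu huv' ?_ ?_ ?_
    · refine Subgroup.le_normalizer_of_conj_mem fun b hb a ha => ?_
      have := conj_mem_ballStabilizer G (b := b) ha
      rwa [mem_stabilizer_iff.1 hb] at this
    · exact fun N hN h1 h2 => eq_bot_of_le_normalizer hΓ hgv htrans (hN.trans inf_le_left) h1 h2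
    · exact fun M _ h1 => hL.transitive_or_le_ballStabilizer hsurj hφ ω h1
    · exact relPCore_le_ballStabilizer hsurj hφ hω
  have hKvi : Kv.relIndex H ≤ Nat.card L :=
    (Subgroup.relIndex_le_of_le_right inf_le_left Subgroup.index_ne_zero_of_finite).trans (relIndex_ballStabilizer_le hφ)
  have hKui : Ku.relIndex H = Kv.relIndex H := by
    have hmapK : Kv.map (MulAut.conj g).toMonoidHom = Ku := by
      ext a
      rw [Subgroup.mem_map_equiv]
      have := hvu (g⁻¹ * a * g)
      simpa [mul_assoc] using this
    have hmapH : H.map (MulAut.conj g).toMonoidHom = H :=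
      Subgroup.mem_normalizer_iff_map_conj_eq.1 hgH
    rw [← hmapK, ← hmapH, Subgroup.relIndex_map_map_of_injective _ _ (MulAut.conj g).injective,
      hmapH]
  have hi : (Kv ⊓ Ku).relIndex H ≤ Nat.card L * Nat.card L :=
    Subgroup.relIndex_inf_le.trans (Nat.mul_le_mul hKvi (hKui.trans_le hKvi))
  have hcard : Nat.card (Kv ⊓ Ku : Subgroup G) * (Kv ⊓ Ku).relIndex H = Nat.card H := by
    have := Subgroup.card_mul_index ((Kv ⊓ Ku).subgroupOf H)
    rwa [Nat.card_congr (Subgroup.subgroupOfEquivOfLe (inf_le_left.trans hKvH)).toEquiv] at this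
  have hne : (Kv ⊓ Ku).relIndex H ≠ 0 := Subgroup.index_ne_zero_of_finite
  rw [← hcard, Nat.factorization_mul Nat.card_pos.ne' hne, Finsupp.add_apply,
    Nat.factorization_eq_zero_of_not_dvd hndvd, zero_add]
  exact (Nat.ordProj_le p hne).trans hi

end

theorem card_arcStabilizer_smul (a : G) (u v : V) :
    Nat.card (arcStabilizer G (a • u) (a • v)) = Nat.card (arcStabilizer G u v) := by
  have : arcStabilizer G (a • u) (a • v) =
      (arcStabilizer G u v).map (MulAut.conj a).toMonoidHom := by
    rw [arcStabilizer, arcStabilizer, stabilizer_smul_eq_stabilizer_map_conj,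
      stabilizer_smul_eq_stabilizer_map_conj, Subgroup.map_inf _ _ _ (MulAut.conj a).injective]
  rw [this]
  exact Subgroup.card_map_of_injective (MulAut.conj a).injective

end LocalAction

theorem corollary2p3 {Ω : Type u} (L : Subgroup (Equiv.Perm Ω)) (hL : IsSemiprimitive L)
    (x : Ω) (p : ℕ) (hp : p.Prime) (hx : pCore p (MulAction.stabilizer L x) = ⊥) :
    IsPGraphRestrictive.{u, w} p L := by
  have := hL.1
  -- For infinite Ω this constant is 0, harmlessly: no finite graph is then locally-L.
  refine ⟨hL.1, Nat.card L * Nat.card L, fun V _ Γ G hloc u v huv => ?_⟩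
  obtain ⟨v₀, hv₀⟩ := hloc.local_iso
  obtain ⟨e, φ, hsurj, hφ⟩ := hv₀.exists_hom
  have := hloc.vertexTransitive
  obtain ⟨a, ha⟩ := exists_smul_eq G u v₀
  have hadj : Γ.Adj v₀ (a • v) := by
    rw [← ha]; exact (smul_adj_smul_iff G a).2 huv
  -- The given arc is moved to the one from v₀ to `e x`, where the hypothesis on L_x applies.
  obtain ⟨b, hb, hbv⟩ := exists_smul_eq_of_adj hsurj hφ hadj (e x).2
  have hbu : (b * a) • u = v₀ := by rw [mul_smul, ha, mem_stabilizer_iff.1 hb]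
  rw [← card_arcStabilizer_smul G (b * a) u v, hbu, mul_smul, hbv]
  exact ordProj_card_inf_stabilizer_le hp hL hloc.connected hloc.vertexTransitive hsurj hφ hx
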